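/- Let $X$ and $Y$ be Polish spaces with their Borel $\sigma$-algebras and let $c\colon X\times Y\to[0,\infty)$ be continuous. For a probability measure $\gamma$ on $X\times Y$ let its cost be $\int c\,d\gamma\in[0,\infty]$, and call $\gamma$ an optimal coupling of $\mu$ and $\nu$ if its marginals are $\mu$ and $\nu$ and its cost equals the optimal transport cost $C(\mu,\nu)$, the infimum of the costs of all couplings of $\mu$ and $\nu$. Let $\gamma_1$ and $\gamma_2$ be probability measures on $X\times Y$, each an optimal coupling of its own marginals, such that (i) $\gamma_1,\gamma_2$ are $c$-CM compatible: the set $\Gamma=\operatorname{supp}\gamma_1\cup\operatorname{supp}\gamma_2$ is $c$-cyclically monotone, i.e. $\sum_{i=1}^N c(x_i,y_i)\le\sum_{i=1}^N c(x_i,y_{\sigma(i)})$ for all $N$, all $(x_1,y_1),\dots,(x_N,y_N)\in\Gamma$ and all permutations $\sigma$ of $\{1,\dots,N\}$; (ii) the $X$-supports are disjoint: $\operatorname{supp}\big((\operatorname{proj}_X)_\#\gamma_1\big)\cap\operatorname{supp}\big((\operatorname{proj}_X)_\#\gamma_2\big)=\emptyset$. Then there exist probability measures $\mu_1,\mu_2$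 on $X$ and a Markov kernel $K$ from $X$ to $Y$ such that $$\gamma_1=\mu_1\odot K,\qquad \gamma_2=\mu_2\odot K,$$ and $K$ is an optimal transport kernel for $c$ on the measures absolutely continuous with respect to $\mu_1+\mu_2$: for every probability measure $\eta\ll\mu_1+\mu_2$ on $X$ with $C(\eta,\eta K)<\infty$, the measure $\eta\odot K$ is an optimal coupling of $\eta$ and $\eta K$. Here $(\eta\odot K)(A\times B)=\int_A K(x,B)\,d\eta(x)$ and $(\eta K)(B)=\int_X K(x,B)\,d\eta(x)$. -/

import Mathlib

open MeasureTheory ProbabilityTheory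
open scoped NNReal ENNReal

/-- A set `Γ ⊆ X × Y` is `c`-cyclically monotone: for every finite family of points of `Γ`,
no permutation of the second coordinates lowers the total cost. -/
def IsCCyclicallyMonotone {X Y : Type*} (c : X × Y → ℝ≥0) (Γ : Set (X × Y)) : Prop :=
  ∀ (N : ℕ) (p : Fin N → X × Y), (∀ i, p i ∈ Γ) → ∀ σ : Equiv.Perm (Fin N),
    ∑ i, c (p i) ≤ ∑ i, c ((p i).1, (p (σ i)).2)

/-- `γ` is a coupling of `μ` and `ν`: a probability measure on `X × Y` with marginals `μ`, `ν`. -/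
structure IsCoupling {X Y : Type*} [MeasurableSpace X] [MeasurableSpace Y]
    (μ : Measure X) (ν : Measure Y) (γ : Measure (X × Y)) : Prop where
  isProbabilityMeasure : IsProbabilityMeasure γ
  map_fst : γ.map Prod.fst = μ
  map_snd : γ.map Prod.snd = ν

/-- The cost `C(γ) = ∫ c dγ`, possibly infinite. -/
noncomputable def couplingCost {X Y : Type*} [MeasurableSpace X] [MeasurableSpace Y]
    (c : X × Y → ℝ≥0) (γ : Measure (X × Y)) : ℝ≥0∞ :=
  ∫⁻ z, (c z : ℝ≥0∞) ∂γ

/-- The optimal transport cost `C(μ, ν)`: the infimum of the cost over all couplings. -/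
noncomputable def transportCost {X Y : Type*} [MeasurableSpace X] [MeasurableSpace Y]
    (c : X × Y → ℝ≥0) (μ : Measure X) (ν : Measure Y) : ℝ≥0∞ :=
  ⨅ (π : Measure (X × Y)) (_ : IsCoupling μ ν π), couplingCost c π

/-- `γ` is an optimal coupling of `μ` and `ν`: a coupling that attains the infimal cost. -/
structure IsOptimalCoupling {X Y : Type*} [MeasurableSpace X] [MeasurableSpace Y]
    (c : X × Y → ℝ≥0) (μ : Measure X) (ν : Measure Y) (γ : Measure (X × Y)) : Prop where
  isCoupling : IsCoupling μ ν γ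
  cost_eq : couplingCost c γ = transportCost c μ ν

/-- Two couplings are `c`-CM compatible if the union of their (closed topological) supports is
`c`-cyclically monotone. -/
def CMCompatible {X Y : Type*} [TopologicalSpace X] [MeasurableSpace X]
    [TopologicalSpace Y] [MeasurableSpace Y]
    (c : X × Y → ℝ≥0) (γ₁ γ₂ : Measure (X × Y)) : Prop :=
  IsCCyclicallyMonotone c (γ₁.support ∪ γ₂.support)

/-- The `X`-support of `γ`: the support of its `X`-marginal. -/
def xSupport {X Y : Type*} [TopologicalSpace X] [MeasurableSpace X] [MeasurableSpace Y]
    (γ : Measure (X × Y)) : Set X :=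
  (γ.map Prod.fst).support

/-- `K` is an optimal transport kernel on the class `𝒜` of measures: it is a Markov kernel, and
for every probability measure `η` in `𝒜` such that the transport problem between `η` and `η K` has
finite cost, `η ⊙ K` is an optimal coupling of `η` and `η K`. Here `η ⊙ K` is `η ⊗ₘ K` and `η K` is
`K ∘ₘ η`. -/
structure IsOptimalTransportKernelOn {X Y : Type*} [MeasurableSpace X] [MeasurableSpace Y]
    (c : X × Y → ℝ≥0) (K : Kernel X Y) (𝒜 : Set (Measure X)) : Prop where
  isMarkovKernel : IsMarkovKernel K
  optimal : ∀ η ∈ 𝒜, IsProbabilityMeasure η → transportCost c η (K ∘ₘ η) < ∞ →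
    IsOptimalCoupling c η (K ∘ₘ η) (η ⊗ₘ K)

/-! Take `K` to be the conditional kernel of `γ₁ + γ₂` given the first coordinate. The `X`-marginals
have disjoint supports, so restriction to the cylinder over one support recovers each `γᵢ` as `μᵢ ⊗ₘ
K`. If `η ≪ μ₁ + μ₂`, then `η ⊗ₘ K ≪ γ₁ + γ₂`, so `η ⊗ₘ K` is carried by the union of the supports,
which is cyclically monotone. It remains that cyclical monotonicity implies optimality:
`exists_potentials` gives `φ + ψ ≤ c` with equality on `Γ`, and `couplingCost_le_of_potentials`
compares costs through truncated potentials, since `φ` and `ψ` need not be integrable. -/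

/-! ### Potentials of a cyclically monotone set -/

/-- The index set of chains in `Γ` starting at a prescribed point: a length and a sequence. -/
def Chain {Z : Type*} (Γ : Set Z) (z₀ : Z) : Type _ :=
  {q : ℕ × (ℕ → Z) // (∀ i, q.2 i ∈ Γ) ∧ q.2 0 = z₀}

/-- The accumulated cost of a chain that is closed up at the point `x`. -/
noncomputable def chainCost {X Y : Type*} (c : X × Y → ℝ≥0) (n : ℕ) (p : ℕ → X × Y) (x : X) : ℝ :=
  ∑ i ∈ Finset.range n, ((c ((p (i + 1)).1, (p i).2) : ℝ) - c (p i)) +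
    ((c (x, (p n).2) : ℝ) - c (p n))

lemma IsCCyclicallyMonotone.chainCost_nonneg {X Y : Type*} {c : X × Y → ℝ≥0} {Γ : Set (X × Y)}
    (h : IsCCyclicallyMonotone c Γ) (n : ℕ) (p : ℕ → X × Y) (hp : ∀ i, p i ∈ Γ) :
    0 ≤ chainCost c n p (p 0).1 := by
  -- The inverse rotation, once the sum is reindexed, pairs the first coordinate of `p (i + 1)` with
  -- the second of `p i`.
  have key := h (n + 1) (fun i => p i) (fun i => hp i) (finRotate (n + 1)).symm
  rw [← Equiv.sum_comp (finRotate (n + 1))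
    (fun i : Fin (n + 1) => c ((p i).1, (p ((finRotate (n + 1)).symm i : Fin (n + 1))).2))] at key
  simp only [Equiv.symm_apply_apply] at key
  rw [Fin.sum_univ_castSucc, Fin.sum_univ_castSucc (n := n)
    (f := fun i : Fin (n + 1) => c ((p (finRotate (n + 1) i : Fin (n + 1))).1, (p i).2))] at key
  have e : ∀ i : Fin n, ((finRotate (n + 1) i.castSucc : Fin (n + 1)) : ℕ) = i + 1 := by
    intro i
    rw [finRotate_apply, Fin.coeSucc_eq_succ, Fin.val_succ]
  simp only [e, finRotate_last, Fin.val_castSucc, Fin.val_last, Fin.val_zero] at key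
  rw [Fin.sum_univ_eq_sum_range (fun i => c (p i)),
    Fin.sum_univ_eq_sum_range (fun i => c ((p (i + 1)).1, (p i).2))] at key
  have key' : (∑ i ∈ Finset.range n, (c (p i) : ℝ)) + c (p n) ≤
      (∑ i ∈ Finset.range n, (c ((p (i + 1)).1, (p i).2) : ℝ)) + c ((p 0).1, (p n).2) := by
    exact_mod_cast key
  rw [chainCost, Finset.sum_sub_distrib]
  linarith

lemma chainCost_update {X Y : Type*} (c : X × Y → ℝ≥0) (n : ℕ) (p : ℕ → X × Y) (z : X × Y)
    (x : X) : chainCost c (n + 1) (Function.update p (n + 1) z) x =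
      chainCost c n p z.1 + (c (x, z.2) - c z) := by
  have h : ∀ i ≤ n, Function.update p (n + 1) z i = p i := fun i hi =>
    Function.update_of_ne (by omega) _ _
  unfold chainCost
  rw [Finset.sum_range_succ, Function.update_self, h n le_rfl]
  congr 2
  refine Finset.sum_congr rfl fun i hi => ?_
  rw [Finset.mem_range] at hi
  rw [h i hi.le, h (i + 1) hi]

/-- Rockafellar–Rüschendorf: a nonempty `c`-cyclically monotone set, with `c` continuous and
finite, is contained in the contact set of a pair of Borel potentials. -/
theorem IsCCyclicallyMonotone.exists_potentials {X Y : Type*}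
    [TopologicalSpace X] [MeasurableSpace X] [BorelSpace X]
    [TopologicalSpace Y] [MeasurableSpace Y] [BorelSpace Y]
    {c : X × Y → ℝ≥0} (hc : Continuous c) {Γ : Set (X × Y)}
    (h : IsCCyclicallyMonotone c Γ) (hne : Γ.Nonempty) :
    ∃ (φ : X → EReal) (ψ : Y → EReal), Measurable φ ∧ Measurable ψ ∧
      (∀ x, φ x ≠ ⊤) ∧ (∀ y, ψ y ≠ ⊤) ∧
      (∀ x y, φ x + ψ y ≤ ((c (x, y) : ℝ) : EReal)) ∧
      ∀ z ∈ Γ, φ z.1 + ψ z.2 = ((c z : ℝ) : EReal) := by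
  obtain ⟨z₀, hz₀⟩ := hne
  let φ : X → EReal := fun x => ⨅ q : Chain Γ z₀, ((chainCost c q.1.1 q.1.2 x : ℝ) : EReal)
  have hφtop : ∀ x, φ x ≠ ⊤ := fun x => ne_top_of_le_ne_top (EReal.coe_ne_top _)
    (iInf_le _ (⟨(0, fun _ => z₀), fun _ => hz₀, rfl⟩ : Chain Γ z₀))
  -- Appending `z` to any chain gives a competitor in the infimum at `x`.
  have hstep : ∀ z ∈ Γ, ∀ x, φ x ≤ φ z.1 + (((c (x, z.2) : ℝ) - c z : ℝ) : EReal) := by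
    intro z hz x
    rw [← EReal.sub_le_iff_le_add (.inl (EReal.coe_ne_bot _)) (.inl (EReal.coe_ne_top _))]
    refine le_iInf fun q => ?_
    rw [EReal.sub_le_iff_le_add (.inl (EReal.coe_ne_bot _)) (.inl (EReal.coe_ne_top _)),
      ← EReal.coe_add, ← chainCost_update]
    refine iInf_le_of_le (⟨(q.1.1 + 1, Function.update q.1.2 (q.1.1 + 1) z), ?_, ?_⟩ :
      Chain Γ z₀) le_rfl
    · intro i
      rcases eq_or_ne i (q.1.1 + 1) with rfl | hi
      · simpa using hz
      · simpa [hi] using q.2.1 i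
    · simpa using q.2.2
  have hφ₀ : (0 : EReal) ≤ φ z₀.1 := by
    refine le_iInf fun q => ?_
    have := h.chainCost_nonneg q.1.1 q.1.2 q.2.1
    rw [q.2.2] at this
    exact_mod_cast this
  -- One step from `z` back to `z₀.1` would carry the value `⊥` there, against `hφ₀`.
  have hφbot : ∀ z ∈ Γ, φ z.1 ≠ ⊥ := by
    intro z hz hb
    have := hφ₀.trans (hstep z hz z₀.1)
    rw [hb, EReal.bot_add] at this
    exact absurd this (by simp)
  -- On `S` the potential `φ` is real, so each `c - φ` is a real continuous function of `y`.
  let S : Set X := {x | φ x ≠ ⊥}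
  let ψ : Y → EReal := fun y =>
    ⨅ x : S, (((c (x.1, y) : ℝ) - (φ x.1).toReal : ℝ) : EReal)
  have hψle : ∀ x y, φ x ≠ ⊥ → ψ y ≤ (((c (x, y) : ℝ) - (φ x).toReal : ℝ) : EReal) :=
    fun x y hx => iInf_le_of_le (⟨x, hx⟩ : S) le_rfl
  have hcoe : ∀ x, φ x ≠ ⊥ → (((φ x).toReal : ℝ) : EReal) = φ x :=
    fun x hx => EReal.coe_toReal (hφtop x) hx
  have hle : ∀ x y, φ x + ψ y ≤ ((c (x, y) : ℝ) : EReal) := by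
    intro x y
    by_cases hx : φ x = ⊥
    · rw [hx, EReal.bot_add]; exact bot_le
    · calc φ x + ψ y ≤ φ x + (((c (x, y) : ℝ) - (φ x).toReal : ℝ) : EReal) := by
            gcongr; exact hψle x y hx
        _ = ((c (x, y) : ℝ) : EReal) := by
            rw [← hcoe x hx, EReal.toReal_coe, ← EReal.coe_add]; congr 1; ring
  refine ⟨φ, ψ, ?_, ?_, hφtop, ?_, hle, ?_⟩
  -- The infimum may be uncountable; semicontinuity, not countability, yields measurability.
  · refine (upperSemicontinuous_iInf fun q => Continuous.upperSemicontinuous ?_).measurable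
    refine continuous_coe_real_ereal.comp ?_
    unfold chainCost
    fun_prop
  · refine (upperSemicontinuous_iInf fun q => Continuous.upperSemicontinuous ?_).measurable
    exact continuous_coe_real_ereal.comp (by fun_prop)
  · exact fun y => ne_top_of_le_ne_top (EReal.coe_ne_top _) (hψle z₀.1 y (hφbot z₀ hz₀))
  · intro z hz
    refine le_antisymm (hle z.1 z.2) ?_
    have hb := hφbot z hz
    have : (((c z : ℝ) - (φ z.1).toReal : ℝ) : EReal) ≤ ψ z.2 := by
      refine le_iInf fun x => ?_
      have := hstep z hz x.1
      rw [← hcoe _ hb, ← hcoe _ x.2, ← EReal.coe_add, EReal.coe_le_coe_iff] at this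
      rw [EReal.coe_le_coe_iff]
      linarith
    calc ((c z : ℝ) : EReal) = φ z.1 + (((c z : ℝ) - (φ z.1).toReal : ℝ) : EReal) := by
          rw [← hcoe _ hb, EReal.toReal_coe, ← EReal.coe_add]; congr 1; ring
      _ ≤ φ z.1 + ψ z.2 := by gcongr

/-! ### Truncated potentials and optimality -/

/-- Truncation of an extended real to `[-n, n]`. -/
noncomputable def truncate (n : ℕ) (a : EReal) : ℝ :=
  (max (((-n : ℝ)) : EReal) (min ((n : ℝ) : EReal) a)).toReal

lemma truncate_coe (n : ℕ) (a : ℝ) : truncate n a = max (-(n : ℝ)) (min (n : ℝ) a) := by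
  rw [truncate, ← EReal.coe_strictMono.monotone.map_min, ← EReal.coe_strictMono.monotone.map_max,
    EReal.toReal_coe]

lemma truncate_bot (n : ℕ) : truncate n ⊥ = -n := by
  rw [truncate, min_bot_right, max_bot_right, EReal.toReal_coe]

lemma measurable_truncate (n : ℕ) : Measurable (truncate n) := by
  unfold truncate
  fun_prop

lemma neg_le_truncate (n : ℕ) (a : EReal) (ha : a ≠ ⊤) : -(n : ℝ) ≤ truncate n a := by
  induction a with
  | bot => rw [truncate_bot]
  | coe a => rw [truncate_coe]; exact le_max_left _ _
  | top => exact absurd rfl ha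

lemma truncate_le (n : ℕ) (a : EReal) (ha : a ≠ ⊤) : truncate n a ≤ n := by
  have hn : (0 : ℝ) ≤ n := n.cast_nonneg
  induction a with
  | bot => rw [truncate_bot]; linarith
  | coe a => rw [truncate_coe]; exact max_le (by linarith) (min_le_left _ _)
  | top => exact absurd rfl ha

/-- If one term is raised to `-n`, the sum is at most `0 ≤ r`; otherwise truncation only decreases
both terms. -/
lemma truncate_add_truncate_le (n : ℕ) {a b : EReal} (ha : a ≠ ⊤) (hb : b ≠ ⊤) {r : ℝ}
    (hr : 0 ≤ r) (h : a + b ≤ r) : truncate n a + truncate n b ≤ r := by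
  have hn : (0 : ℝ) ≤ n := n.cast_nonneg
  have h₁ := truncate_le n a ha
  have h₂ := truncate_le n b hb
  induction a with
  | bot => rw [truncate_bot]; linarith
  | top => exact absurd rfl ha
  | coe a =>
    induction b with
    | bot => rw [truncate_bot]; linarith
    | top => exact absurd rfl hb
    | coe b =>
      rw [← EReal.coe_add, EReal.coe_le_coe_iff] at h
      rw [truncate_coe, truncate_coe]
      rcases max_cases (-(n : ℝ)) (min n a) with ⟨e₁, _⟩ | ⟨e₁, _⟩ <;>
      rcases max_cases (-(n : ℝ)) (min n b) with ⟨e₂, _⟩ | ⟨e₂, _⟩ <;>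
      rcases min_cases (n : ℝ) a with ⟨e₃, _⟩ | ⟨e₃, _⟩ <;>
      rcases min_cases (n : ℝ) b with ⟨e₄, _⟩ | ⟨e₄, _⟩ <;> linarith

/-- Truncation is monotone and odd, and `a ≥ -b`. -/
lemma truncate_add_truncate_nonneg (n : ℕ) {a b : ℝ} (h : 0 ≤ a + b) :
    0 ≤ truncate n a + truncate n b := by
  have hn : (0 : ℝ) ≤ n := n.cast_nonneg
  rw [truncate_coe, truncate_coe]
  rcases max_cases (-(n : ℝ)) (min n a) with ⟨e₁, _⟩ | ⟨e₁, _⟩ <;>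
  rcases max_cases (-(n : ℝ)) (min n b) with ⟨e₂, _⟩ | ⟨e₂, _⟩ <;>
  rcases min_cases (n : ℝ) a with ⟨e₃, _⟩ | ⟨e₃, _⟩ <;>
  rcases min_cases (n : ℝ) b with ⟨e₄, _⟩ | ⟨e₄, _⟩ <;> linarith

lemma eventually_truncate_eq (a : ℝ) : ∀ᶠ n : ℕ in Filter.atTop, truncate n a = a := by
  filter_upwards [Filter.eventually_ge_atTop ⌈|a|⌉₊] with n hn
  have := abs_le.1 (Nat.ceil_le.1 hn)
  rw [truncate_coe, min_eq_right this.2, max_eq_right this.1]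

/-- A coupling carried by the contact set of a pair of measurable potentials is optimal. -/
theorem couplingCost_le_of_potentials {X Y : Type*} [MeasurableSpace X] [MeasurableSpace Y]
    {c : X × Y → ℝ≥0} {φ : X → EReal} {ψ : Y → EReal}
    (hφ : Measurable φ) (hψ : Measurable ψ) (hφtop : ∀ x, φ x ≠ ⊤) (hψtop : ∀ y, ψ y ≠ ⊤)
    (hle : ∀ x y, φ x + ψ y ≤ ((c (x, y) : ℝ) : EReal))
    {μ : Measure X} {ν : Measure Y} {γ π : Measure (X × Y)}
    (hγ : IsCoupling μ ν γ) (hπ : IsCoupling μ ν π)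
    (heq : ∀ᵐ z ∂γ, φ z.1 + ψ z.2 = ((c z : ℝ) : EReal)) :
    couplingCost c γ ≤ couplingCost c π := by
  have := hγ.isProbabilityMeasure
  have := hπ.isProbabilityMeasure
  have hφn : ∀ n, Measurable fun x => truncate n (φ x) := fun n => (measurable_truncate n).comp hφ
  have hψn : ∀ n, Measurable fun y => truncate n (ψ y) := fun n => (measurable_truncate n).comp hψ
  have hφn' : ∀ n, Measurable fun z : X × Y => truncate n (φ z.1) :=
    fun n => (hφn n).comp measurable_fst
  have hψn' : ∀ n, Measurable fun z : X × Y => truncate n (ψ z.2) :=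
    fun n => (hψn n).comp measurable_snd
  -- The shift by `n` makes each term nonnegative, so the integral depends only on the marginals.
  have hsplit : ∀ (n : ℕ) (ρ : Measure (X × Y)), IsCoupling μ ν ρ →
      ∫⁻ z, ENNReal.ofReal (truncate n (φ z.1) + truncate n (ψ z.2) + 2 * n) ∂ρ =
        ∫⁻ x, ENNReal.ofReal (truncate n (φ x) + n) ∂μ +
          ∫⁻ y, ENNReal.ofReal (truncate n (ψ y) + n) ∂ν := by
    intro n ρ hρ
    have hφm := ((hφn n).add_const (n : ℝ)).ennreal_ofReal
    have hψm := ((hψn n).add_const (n : ℝ)).ennreal_ofReal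
    rw [← hρ.map_fst, ← hρ.map_snd, lintegral_map hφm measurable_fst,
      lintegral_map hψm measurable_snd,
      ← lintegral_add_left (f := fun z : X × Y => ENNReal.ofReal (truncate n (φ z.1) + n))
        (hφm.comp measurable_fst)]
    refine lintegral_congr fun z => ?_
    have h₁ := neg_le_truncate n (φ z.1) (hφtop _)
    have h₂ := neg_le_truncate n (ψ z.2) (hψtop _)
    rw [← ENNReal.ofReal_add (by linarith) (by linarith)]
    congr 1
    ring
  have hreal : ∀ᵐ z ∂γ, ∃ a b : ℝ, φ z.1 = a ∧ ψ z.2 = b ∧ a + b = c z := by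
    filter_upwards [heq] with z hz
    have h₁ : φ z.1 ≠ ⊥ := fun hb => by rw [hb, EReal.bot_add] at hz; exact EReal.bot_ne_coe _ hz
    have h₂ : ψ z.2 ≠ ⊥ := fun hb => by rw [hb, EReal.add_bot] at hz; exact EReal.bot_ne_coe _ hz
    refine ⟨_, _, (EReal.coe_toReal (hφtop _) h₁).symm, (EReal.coe_toReal (hψtop _) h₂).symm, ?_⟩
    rw [← EReal.coe_toReal (hφtop _) h₁, ← EReal.coe_toReal (hψtop _) h₂] at hz
    exact_mod_cast hz
  have hn : ∀ n : ℕ, ∫⁻ z, ENNReal.ofReal (truncate n (φ z.1) + truncate n (ψ z.2)) ∂γ ≤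
      couplingCost c π := by
    intro n
    have hfin : ENNReal.ofReal (2 * n) ≠ ∞ := ENNReal.ofReal_ne_top
    refine (ENNReal.add_le_add_iff_right hfin).1 ?_
    calc ∫⁻ z, ENNReal.ofReal (truncate n (φ z.1) + truncate n (ψ z.2)) ∂γ + ENNReal.ofReal (2 * n)
        = ∫⁻ z, ENNReal.ofReal (truncate n (φ z.1) + truncate n (ψ z.2) + 2 * n) ∂γ := by
          rw [← mul_one (ENNReal.ofReal (2 * n)), ← measure_univ (μ := γ), ← lintegral_const,
            ← lintegral_add_right _ measurable_const]
          refine lintegral_congr_ae ?_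
          filter_upwards [hreal] with z ⟨a, b, ha, hb, hab⟩
          have h0 : (0 : ℝ) ≤ a + b := by rw [hab]; positivity
          rw [ha, hb, ENNReal.ofReal_add (truncate_add_truncate_nonneg n h0) (by positivity)]
      _ = ∫⁻ z, ENNReal.ofReal (truncate n (φ z.1) + truncate n (ψ z.2) + 2 * n) ∂π := by
          rw [hsplit n γ hγ, hsplit n π hπ]
      _ ≤ ∫⁻ z, ((c z : ℝ≥0∞) + ENNReal.ofReal (2 * n)) ∂π := by
          refine lintegral_mono fun z => ?_
          rw [← ENNReal.ofReal_coe_nnreal, ← ENNReal.ofReal_add (by positivity) (by positivity)]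
          refine ENNReal.ofReal_le_ofReal (add_le_add_left ?_ _)
          exact truncate_add_truncate_le n (hφtop _) (hψtop _) (by positivity) (hle z.1 z.2)
      _ = couplingCost c π + ENNReal.ofReal (2 * n) := by
          rw [lintegral_add_right _ measurable_const, lintegral_const, measure_univ, mul_one,
            couplingCost]
  -- Fatou: `γ`-almost everywhere the truncated sums eventually equal `c`.
  calc couplingCost c γ
      ≤ ∫⁻ z, Filter.liminf (fun n : ℕ =>
          ENNReal.ofReal (truncate n (φ z.1) + truncate n (ψ z.2))) Filter.atTop ∂γ := by
        refine lintegral_mono_ae ?_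
        filter_upwards [hreal] with z ⟨a, b, ha, hb, hab⟩
        refine Filter.le_liminf_of_le (by isBoundedDefault) ?_
        filter_upwards [eventually_truncate_eq a, eventually_truncate_eq b] with n h₁ h₂
        rw [ha, hb, h₁, h₂, hab, ENNReal.ofReal_coe_nnreal]
    _ ≤ Filter.liminf (fun n : ℕ =>
          ∫⁻ z, ENNReal.ofReal (truncate n (φ z.1) + truncate n (ψ z.2)) ∂γ) Filter.atTop :=
        lintegral_liminf_le fun n => ((hφn' n).add (hψn' n)).ennreal_ofReal
    _ ≤ couplingCost c π := Filter.liminf_le_of_frequently_le'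
        (Filter.Frequently.of_forall hn)

/-- For a finite continuous cost, a coupling carried by a `c`-cyclically monotone set is optimal. -/
theorem IsCCyclicallyMonotone.isOptimalCoupling {X Y : Type*}
    [TopologicalSpace X] [MeasurableSpace X] [BorelSpace X]
    [TopologicalSpace Y] [MeasurableSpace Y] [BorelSpace Y]
    {c : X × Y → ℝ≥0} (hc : Continuous c) {Γ : Set (X × Y)} (h : IsCCyclicallyMonotone c Γ)
    {μ : Measure X} {ν : Measure Y} {γ : Measure (X × Y)} (hγ : IsCoupling μ ν γ)
    (hΓ : ∀ᵐ z ∂γ, z ∈ Γ) : IsOptimalCoupling c μ ν γ := by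
  have := hγ.isProbabilityMeasure
  obtain ⟨φ, ψ, hφ, hψ, hφtop, hψtop, hle, heq⟩ := h.exists_potentials hc hΓ.exists
  refine ⟨hγ, le_antisymm (le_iInf₂ fun π hπ => ?_) (iInf₂_le γ hγ)⟩
  exact couplingCost_le_of_potentials hφ hψ hφtop hψtop hle hγ hπ (hΓ.mono heq)

/-! ### Separating the two couplings -/

/-- Restriction to `T` kills the second summands and fixes the first ones. -/
lemma MeasureTheory.Measure.eq_of_add_eq_add_of_null {Z : Type*} [MeasurableSpace Z]
    {ρ₁ ρ₂ ρ₁' ρ₂' : Measure Z} (h : ρ₁ + ρ₂ = ρ₁' + ρ₂') {T : Set Z}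
    (h₁ : ρ₁ Tᶜ = 0) (h₁' : ρ₁' Tᶜ = 0) (h₂ : ρ₂ T = 0) (h₂' : ρ₂' T = 0) : ρ₁ = ρ₁' := by
  have e := congrArg (fun ρ : Measure Z => ρ.restrict T) h
  simpa only [Measure.restrict_add, Measure.restrict_eq_zero.2 h₂, Measure.restrict_eq_zero.2 h₂',
    add_zero, Measure.restrict_eq_self_of_ae_mem (measure_eq_zero_iff_ae_notMem.1 h₁ |>.mono
      fun _ => not_not.1), Measure.restrict_eq_self_of_ae_mem
      (measure_eq_zero_iff_ae_notMem.1 h₁' |>.mono fun _ => not_not.1)] using e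

theorem theorem4 {X Y : Type*}
    [TopologicalSpace X] [PolishSpace X] [MeasurableSpace X] [BorelSpace X]
    [TopologicalSpace Y] [PolishSpace Y] [MeasurableSpace Y] [BorelSpace Y]
    (c : X × Y → ℝ≥0) (hc : Continuous c)
    (γ₁ γ₂ : Measure (X × Y))
    (h₁ : IsOptimalCoupling c (γ₁.map Prod.fst) (γ₁.map Prod.snd) γ₁)
    (h₂ : IsOptimalCoupling c (γ₂.map Prod.fst) (γ₂.map Prod.snd) γ₂)
    (hcomp : CMCompatible c γ₁ γ₂)
    (hdisj : Disjoint (xSupport γ₁) (xSupport γ₂)) :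
    ∃ (K : Kernel X Y) (μ₁ μ₂ : Measure X),
      IsProbabilityMeasure μ₁ ∧ IsProbabilityMeasure μ₂ ∧
      IsOptimalTransportKernelOn c K {η | η ≪ μ₁ + μ₂} ∧
      γ₁ = μ₁ ⊗ₘ K ∧ γ₂ = μ₂ ⊗ₘ K := by
  have := h₁.isCoupling.isProbabilityMeasure
  have := h₂.isCoupling.isProbabilityMeasure
  have : Nonempty Y := γ₁.nonempty_of_neZero.map Prod.snd
  have hp₁ : IsProbabilityMeasure (γ₁.map Prod.fst) :=
    Measure.isProbabilityMeasure_map measurable_fst.aemeasurable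
  have hp₂ : IsProbabilityMeasure (γ₂.map Prod.fst) :=
    Measure.isProbabilityMeasure_map measurable_fst.aemeasurable
  set μ₁ := γ₁.map Prod.fst with hμ₁
  set μ₂ := γ₂.map Prod.fst with hμ₂
  set K := (γ₁ + γ₂).condKernel
  have hdis : (μ₁ + μ₂) ⊗ₘ K = γ₁ + γ₂ := by
    rw [hμ₁, hμ₂, ← Measure.map_add _ _ measurable_fst]
    exact (γ₁ + γ₂).disintegrate K
  have hsum : γ₁ + γ₂ = μ₁ ⊗ₘ K + μ₂ ⊗ₘ K := by rw [← hdis, Measure.compProd_add_left]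
  have hnull : ∀ (ρ : Measure (X × Y)) (S : Set X), MeasurableSet S → ρ.map Prod.fst S = 0 →
      ρ (Prod.fst ⁻¹' S) = 0 := fun ρ S hS h => by rwa [Measure.map_apply measurable_fst hS] at h
  have hmap : ∀ μ : Measure X, IsProbabilityMeasure μ → (μ ⊗ₘ K).map Prod.fst = μ :=
    fun μ _ => Measure.fst_compProd μ K
  have hS₁ : MeasurableSet μ₁.support := Measure.isClosed_support.measurableSet
  have n₁ : μ₁ μ₁.supportᶜ = 0 := Measure.measure_compl_support
  have n₂ : μ₂ μ₁.support = 0 := measure_mono_null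
    (Set.disjoint_left.1 hdisj) Measure.measure_compl_support
  have a₁ := hnull γ₁ _ hS₁.compl n₁
  have a₁' := hnull (μ₁ ⊗ₘ K) _ hS₁.compl (by rwa [hmap μ₁ hp₁])
  have a₂ := hnull γ₂ _ hS₁ n₂
  have a₂' := hnull (μ₂ ⊗ₘ K) _ hS₁ (by rwa [hmap μ₂ hp₂])
  refine ⟨K, μ₁, μ₂, hp₁, hp₂, ⟨inferInstance, fun η hη hηp _ => ?_⟩,
    Measure.eq_of_add_eq_add_of_null hsum a₁ a₁' a₂ a₂', ?_⟩
  · refine hcomp.isOptimalCoupling hc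
      ⟨inferInstance, Measure.fst_compProd η K, Measure.snd_compProd η K⟩ ?_
    have hac : η ⊗ₘ K ≪ γ₁ + γ₂ := hdis ▸ Measure.AbsolutelyContinuous.compProd_left hη K
    refine hac.ae_le ?_
    rw [← Measure.support_add]
    exact Measure.support_mem_ae
  · refine Measure.eq_of_add_eq_add_of_null (T := (Prod.fst ⁻¹' μ₁.support)ᶜ) (by
      rw [add_comm, hsum, add_comm]) ?_ ?_ a₁ a₁' <;> rwa [compl_compl]
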